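/- Let $L$ be a finite-dimensional solvable Lie algebra over a field $F$ (of any characteristic). The Frattini subalgebra $\phi(L)$ is the intersection of all maximal subalgebras of $L$ (and $\phi(L)=L$ if $L=0$); $L$ is called $\phi$-free if $\phi(L)=0$. Let $0=A_0\subset A_1\subset\dots\subset A_n=L$ be a chief series of $L$, i.e. a chain of ideals of $L$ in which no further ideal can be inserted; such a series exists. The factor $A_i/A_{i-1}$ is Frattini if $A_i/A_{i-1}\subseteq\phi(L/A_{i-1})$. Let $\mathcal I$ be the set of those $i\in\{1,\dots,n\}$ for which $A_i/A_{i-1}$ is not Frattini, and for $i\in\mathcal I$ let $\mathcal M_i$ be the set of maximal subalgebras $M$ of $L$ with $A_{i-1}\subseteq M$ and $A_i\not\subseteq M$. A prefrattini subalgebra of $L$ is a subalgebra of the form $\bigcap_{i\in\mathcal I}M_i$ with $M_i\in\mathcal M_i$ for every $i\in\mathcal I$ (the empty intersection being $L$). Then, whichever chief series is used to form the prefrattini subalgebras, the following are equivalent: (i) $L$ is complemented, i.e. for every subalgebra $S$ of $L$ there is a subalgebra $T$ of $L$ such that $S\cap T=0$ and $S$ and $T$ together generate $L$ as a Lie algebra;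 (ii) every prefrattini subalgebra of $L$ is $0$; (iii) $L$ and all its epimorphic images are $\phi$-free; (iv) $L$ splits over each of its ideals, i.e. for every ideal $I$ of $L$ there is a subalgebra $C$ of $L$ such that $L=I+C$ and $I\cap C=0$. -/

import Mathlib

universe u

/-- The Frattini subalgebra `φ(L)`: the intersection of all maximal subalgebras of `L`
(all of `L` if there are none). -/
def LieAlgebra.frattini (F L : Type*) [CommRing F] [LieRing L] [LieAlgebra F L] :
    LieSubalgebra F L :=
  sInf {M : LieSubalgebra F L | IsCoatom M}

/-- `L` is `φ`-free if its Frattini subalgebra is zero. -/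
def LieAlgebra.IsPhiFree (F L : Type*) [CommRing F] [LieRing L] [LieAlgebra F L] : Prop :=
  LieAlgebra.frattini F L = ⊥

/-- `L` splits over the ideal `I` if `L` is the vector space direct sum of `I` and some
subalgebra. -/
def LieAlgebra.SplitsOver {F L : Type*} [CommRing F] [LieRing L] [LieAlgebra F L]
    (I : LieIdeal F L) : Prop :=
  ∃ C : LieSubalgebra F L, IsCompl I.toSubmodule C.toSubmodule

/-- A chief series `0 = A₀ ⊂ A₁ ⊂ ⋯ ⊂ Aₙ = L`: a maximal finite chain of ideals of `L`. -/
structure LieAlgebra.ChiefSeries (F L : Type*) [CommRing F] [LieRing L] [LieAlgebra F L] where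
  length : ℕ
  ideal : Fin (length + 1) → LieIdeal F L
  ideal_zero : ideal 0 = ⊥
  ideal_last : ideal (Fin.last length) = ⊤
  covBy : ∀ i : Fin length, ideal i.castSucc ⋖ ideal i.succ

namespace LieAlgebra.ChiefSeries

variable {F L : Type*} [CommRing F] [LieRing L] [LieAlgebra F L]

/-- The `i`-th factor `A/B` (with `B = ideal i.castSucc` and `A = ideal i.succ`) is a Frattini
chief factor if `A/B ⊆ φ(L/B)`. -/
def IsFrattiniFactor (s : ChiefSeries F L) (i : Fin s.length) : Prop :=
  ∀ x ∈ s.ideal i.succ,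
    (LieSubmodule.Quotient.mk x : L ⧸ s.ideal i.castSucc) ∈
      LieAlgebra.frattini F (L ⧸ s.ideal i.castSucc)

/-- The maximal subalgebras of `L` that contain the lower term of the `i`-th chief factor but
not the upper one. -/
def maximals (s : ChiefSeries F L) (i : Fin s.length) : Set (LieSubalgebra F L) :=
  {M | IsCoatom M ∧ (s.ideal i.castSucc).toLieSubalgebra ≤ M ∧
    ¬ (s.ideal i.succ).toLieSubalgebra ≤ M}

/-- `B` is a prefrattini subalgebra of `L` (formed with the chief series `s`): an intersection of
members of `s.maximals i`, one chosen for each non-Frattini chief factor `i`. -/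
def IsPrefrattini (s : ChiefSeries F L) (B : LieSubalgebra F L) : Prop :=
  ∃ M : Fin s.length → LieSubalgebra F L,
    (∀ i, ¬ s.IsFrattiniFactor i → M i ∈ s.maximals i) ∧
    B = ⨅ (i : Fin s.length) (_ : ¬ s.IsFrattiniFactor i), M i

end LieAlgebra.ChiefSeries

/-! ### Sums of a subalgebra and an ideal; preimages of maximal subalgebras. -/

namespace LieSubalgebra

variable {R L : Type*} [CommRing R] [LieRing L] [LieAlgebra R L]

/-! Everything reduces to chief factors `B/A` having a complement: a subalgebra `M` with `M ∩ B = A`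
and `M + B = L`. Solvability makes chief factors abelian, so a subalgebra that contains `A` and
supplements `B` meets `B` in an ideal, hence in `A` or in `B` (`inf_eq_or_le_of_covBy`). The
subalgebra lattice is not modular, but Dedekind's law over an ideal suffices.

Complemented factors give (i) by descending the series, lifting complements from above `B` to above
`A`. A complement of `B` yields one for `B/A`, so (iv) gives (i). Elements of `φ` are
non-generators, so (i) gives (iii); if all quotients are `φ`-free, complements of ideals can be cut
down one chief factor at a time, giving (iv). Prefrattini subalgebras avoid the non-Frattini factors
and cover the Frattini ones, so they vanish exactly when no factor is Frattini; this ties in (ii).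
-/

theorem mem_sup_toLieSubalgebra {M : LieSubalgebra R L} {I : LieIdeal R L} {x : L} :
    x ∈ M ⊔ I.toLieSubalgebra ↔ ∃ m ∈ M, ∃ a ∈ I, m + a = x := by
  constructor
  · let K : LieSubalgebra R L :=
      { M.toSubmodule ⊔ I.toSubmodule with
        lie_mem' := by
          intro x y hx hy
          obtain ⟨m, hm, a, ha, rfl⟩ := Submodule.mem_sup.1 hx
          obtain ⟨n, hn, b, hb, rfl⟩ := Submodule.mem_sup.1 hy
          refine Submodule.mem_sup.2
            ⟨⁅m, n⁆, M.lie_mem hm hn, ⁅m, b⁆ + ⁅a, n + b⁆, ?_, ?_⟩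
          · exact I.add_mem (lie_mem_right R L I m b hb) (lie_mem_left R L I a (n + b) ha)
          · simp only [lie_add, add_lie]; abel }
    have hK : M ⊔ I.toLieSubalgebra ≤ K :=
      sup_le (fun y hy ↦ Submodule.mem_sup_left hy) (fun y hy ↦ Submodule.mem_sup_right hy)
    intro hx
    exact Submodule.mem_sup.1 (hK hx)
  · rintro ⟨m, hm, a, ha, rfl⟩
    exact add_mem (le_sup_left (a := M) hm)
      (le_sup_right (a := M) (show a ∈ I.toLieSubalgebra from ha))

theorem sup_toLieSubalgebra_toSubmodule (M : LieSubalgebra R L) (I : LieIdeal R L) :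
    (M ⊔ I.toLieSubalgebra).toSubmodule = M.toSubmodule ⊔ I.toSubmodule := by
  ext x
  rw [mem_toSubmodule, mem_sup_toLieSubalgebra, Submodule.mem_sup]
  rfl

/-- Dedekind's modular law for a subalgebra containing an ideal. -/
theorem inf_sup_le_of_toLieSubalgebra_le {X : LieSubalgebra R L} (Y : LieSubalgebra R L)
    {I : LieIdeal R L} (h : I.toLieSubalgebra ≤ X) :
    X ⊓ (Y ⊔ I.toLieSubalgebra) ≤ X ⊓ Y ⊔ I.toLieSubalgebra := by
  rintro x ⟨hxX, hx⟩
  obtain ⟨y, hy, a, ha, rfl⟩ := mem_sup_toLieSubalgebra.1 hx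
  refine mem_sup_toLieSubalgebra.2 ⟨y, (mem_inf _ _ _).2 ⟨?_, hy⟩, a, ha, rfl⟩
  simpa using sub_mem hxX (h ha)

/-- A subalgebra above the preimage contains the kernel, so it is recovered from its image. -/
theorem isCoatom_comap {L' : Type*} [LieRing L'] [LieAlgebra R L'] {f : L →ₗ⁅R⁆ L'}
    (hf : Function.Surjective f) {M : LieSubalgebra R L'} (hM : IsCoatom M) :
    IsCoatom (M.comap f) := by
  refine ⟨fun h ↦ hM.1 (eq_top_iff.2 fun y _ ↦ ?_), fun K hK ↦ eq_top_iff.2 fun x _ ↦ ?_⟩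
  · obtain ⟨x, rfl⟩ := hf y
    exact (mem_comap f M).1 (h ▸ mem_top x)
  · have hker : ∀ z, f z = 0 → z ∈ K := fun z hz ↦ hK.le (by simp [hz])
    have hlt : M < K.map f := by
      refine lt_of_le_of_ne (fun y hy ↦ ?_) ?_
      · obtain ⟨z, rfl⟩ := hf y
        exact (mem_map _ _ _).2 ⟨z, hK.le hy, rfl⟩
      · rintro rfl
        exact hK.not_ge fun z hz ↦ (mem_map _ _ _).2 ⟨z, hz, rfl⟩
    have hx : f x ∈ K.map f := by rw [hM.2 _ hlt]; exact mem_top _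
    obtain ⟨z, hz, hzx⟩ := (mem_map _ _ _).1 hx
    simpa using add_mem hz (hker (x - z) (by simp [hzx]))

end LieSubalgebra

/-! ### Chief factors and their complements. -/

namespace LieIdeal

variable {R L : Type*} [CommRing R] [LieRing L] [LieAlgebra R L]

/-- The quotient map by an ideal, as a morphism of Lie algebras. -/
def quotientMk (I : LieIdeal R L) : L →ₗ⁅R⁆ L ⧸ I :=
  { (LieSubmodule.Quotient.mk' I : L →ₗ[R] L ⧸ I) with
    map_lie' := fun {x y} ↦ LieSubmodule.Quotient.mk_bracket I x y }

theorem quotientMk_surjective (I : LieIdeal R L) : Function.Surjective I.quotientMk :=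
  LieSubmodule.Quotient.surjective_mk' I

theorem quotientMk_eq_zero (I : LieIdeal R L) {x : L} : I.quotientMk x = 0 ↔ x ∈ I :=
  LieSubmodule.Quotient.mk_eq_zero'

/-- The chief factors of a solvable Lie algebra are abelian. -/
theorem lie_le_of_covBy [LieAlgebra.IsSolvable L] {A B : LieIdeal R L} (h : A ⋖ B) :
    ⁅B, B⁆ ≤ A := by
  have hB : A ⊔ ⁅B, B⁆ ≤ B := sup_le h.le (LieSubmodule.lie_le_left B B)
  rcases h.eq_or_eq le_sup_left hB with h' | h'
  · exact h' ▸ le_sup_right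
  · exfalso
    -- Here `B = A + [B, B]`: `B` is perfect modulo `A`, so it lies in every derived term modulo
    -- `A`.
    have key : ∀ k, B ≤ A ⊔ LieAlgebra.derivedSeries R L k := by
      intro k
      induction k with
      | zero => simp
      | succ k ih =>
        have hlie : ⁅B, B⁆ ≤ A ⊔ LieAlgebra.derivedSeries R L (k + 1) := by
          refine (LieSubmodule.mono_lie ih ih).trans ?_
          rw [LieSubmodule.lie_sup, LieSubmodule.sup_lie, LieSubmodule.sup_lie]
          refine sup_le (sup_le ?_ ?_) (sup_le ?_ ?_)
          · exact (LieSubmodule.lie_le_left _ _).trans le_sup_left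
          · exact (LieSubmodule.lie_le_right _ _).trans le_sup_left
          · exact (LieSubmodule.lie_le_left _ _).trans le_sup_left
          · rw [LieAlgebra.derivedSeries_def R L (k + 1),
              LieAlgebra.derivedSeriesOfIdeal_succ]
            exact le_sup_right
        exact h'.ge.trans (sup_le le_sup_left hlie)
    obtain ⟨k, hk⟩ := (LieAlgebra.isSolvable_iff R (L := L)).1 inferInstance
    have := key k
    rw [hk, sup_bot_eq] at this
    exact h.lt.not_ge this

/-- A subalgebra supplementing a chief factor either complements or contains it. -/
theorem inf_eq_or_le_of_covBy [LieAlgebra.IsSolvable L] {A B : LieIdeal R L} (h : A ⋖ B)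
    {U : LieSubalgebra R L} (hA : A.toLieSubalgebra ≤ U) (hU : U ⊔ B.toLieSubalgebra = ⊤) :
    U ⊓ B.toLieSubalgebra = A.toLieSubalgebra ∨ B.toLieSubalgebra ≤ U := by
  -- `U ∩ B` is an ideal: writing `x = u + b`, the part `u` preserves it and `b` sends it into `[B,
  -- B] ≤ A ≤ U`.
  let J : LieIdeal R L :=
    { U.toSubmodule ⊓ B.toSubmodule with
      lie_mem := by
        rintro x m ⟨hmU, hmB⟩
        obtain ⟨u, hu, b, hb, rfl⟩ :=
          LieSubalgebra.mem_sup_toLieSubalgebra.1 (hU ▸ LieSubalgebra.mem_top x)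
        refine ⟨?_, B.lie_mem hmB⟩
        rw [add_lie]
        exact U.add_mem (U.lie_mem hu hmU)
          (hA (lie_le_of_covBy h (LieSubmodule.lie_mem_lie hb hmB))) }
  have hJ : ∀ x, x ∈ J ↔ x ∈ U ∧ x ∈ B := fun x ↦ Iff.rfl
  have hAJ : A ≤ J := fun x hx ↦ (hJ x).2 ⟨hA hx, h.le hx⟩
  have hJB : J ≤ B := fun x hx ↦ ((hJ x).1 hx).2
  rcases h.eq_or_eq hAJ hJB with h' | h'
  · left
    ext x
    rw [LieSubalgebra.mem_inf, mem_toLieSubalgebra, mem_toLieSubalgebra, ← hJ, h']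
  · right
    intro x hx
    have hxJ : x ∈ J := h' ▸ hx
    exact ((hJ x).1 hxJ).1

theorem sup_eq_top_of_isCoatom {B : LieIdeal R L} {M : LieSubalgebra R L} (hM : IsCoatom M)
    (hB : ¬ B.toLieSubalgebra ≤ M) : M ⊔ B.toLieSubalgebra = ⊤ :=
  hM.2 _ (left_lt_sup.2 hB)

theorem inf_eq_of_isCoatom [LieAlgebra.IsSolvable L] {A B : LieIdeal R L} (h : A ⋖ B)
    {M : LieSubalgebra R L} (hM : IsCoatom M) (hA : A.toLieSubalgebra ≤ M)
    (hB : ¬ B.toLieSubalgebra ≤ M) : M ⊓ B.toLieSubalgebra = A.toLieSubalgebra :=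
  (inf_eq_or_le_of_covBy h hA (sup_eq_top_of_isCoatom hM hB)).resolve_right hB

/-- A non-Frattini factor `B/A` is avoided by a maximal subalgebra containing `A`. -/
theorem exists_isCoatom_of_not_mem_frattini {A : LieIdeal R L} {x : L}
    (hx : (LieSubmodule.Quotient.mk x : L ⧸ A) ∉ LieAlgebra.frattini R (L ⧸ A)) :
    ∃ M : LieSubalgebra R L, IsCoatom M ∧ A.toLieSubalgebra ≤ M ∧ x ∉ M := by
  rw [LieAlgebra.frattini, ← SetLike.mem_coe, LieSubalgebra.coe_sInf] at hx
  simp only [Set.mem_iInter, not_forall] at hx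
  obtain ⟨M, hM, hxM⟩ := hx
  refine ⟨M.comap A.quotientMk, LieSubalgebra.isCoatom_comap A.quotientMk_surjective hM,
    fun a ha ↦ ?_, hxM⟩
  rw [LieSubalgebra.mem_comap, A.quotientMk_eq_zero.2 ha]
  exact zero_mem _

/-- If `L ⧸ A` is `φ`-free, then any ideal strictly above `A` is avoided by some maximal
subalgebra containing `A`. -/
theorem exists_isCoatom_of_isPhiFree {A B : LieIdeal R L} (h : A < B)
    (hA : LieAlgebra.IsPhiFree R (L ⧸ A)) :
    ∃ M : LieSubalgebra R L, IsCoatom M ∧ A.toLieSubalgebra ≤ M ∧ ¬ B.toLieSubalgebra ≤ M := by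
  obtain ⟨x, hxB, hxA⟩ := SetLike.exists_of_lt h
  have hx : (LieSubmodule.Quotient.mk x : L ⧸ A) ∉ LieAlgebra.frattini R (L ⧸ A) := by
    rw [hA, LieSubalgebra.mem_bot]
    exact fun h0 ↦ hxA (LieSubmodule.Quotient.mk_eq_zero'.1 h0)
  obtain ⟨M, hM, hAM, hxM⟩ := exists_isCoatom_of_not_mem_frattini hx
  exact ⟨M, hM, hAM, fun hBM ↦ hxM (hBM hxB)⟩

theorem toLieSubalgebra_mono {A B : LieIdeal R L} (h : A ≤ B) :
    A.toLieSubalgebra ≤ B.toLieSubalgebra := fun _ hx ↦ h hx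

/-- A complement of `A` cut down by a supplement of `B` over `A` complements `B`. -/
theorem splitsOver_of_splitsOver {A B : LieIdeal R L} (hAB : A ≤ B) {M : LieSubalgebra R L}
    (hinf : M ⊓ B.toLieSubalgebra = A.toLieSubalgebra) (hsup : M ⊔ B.toLieSubalgebra = ⊤)
    (hA : LieAlgebra.SplitsOver A) : LieAlgebra.SplitsOver B := by
  obtain ⟨C, hC⟩ := hA
  have hAM : A.toLieSubalgebra ≤ M := hinf ▸ inf_le_left
  have hCA : C ⊔ A.toLieSubalgebra = ⊤ := by
    rw [← LieSubalgebra.toSubmodule_eq_top, LieSubalgebra.sup_toLieSubalgebra_toSubmodule,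
      sup_comm]
    exact hC.sup_eq_top
  refine ⟨M ⊓ C, ?_, ?_⟩
  · rw [Submodule.disjoint_def]
    rintro x hxB ⟨hxM, hxC⟩
    have hxA : x ∈ A.toLieSubalgebra := hinf ▸ (LieSubalgebra.mem_inf _ _ _).2 ⟨hxM, hxB⟩
    exact Submodule.disjoint_def.1 hC.disjoint x hxA hxC
  · rw [codisjoint_iff, sup_comm, ← LieSubalgebra.sup_toLieSubalgebra_toSubmodule,
      LieSubalgebra.toSubmodule_eq_top, eq_top_iff, ← hsup]
    refine sup_le ?_ le_sup_right
    calc M = M ⊓ (C ⊔ A.toLieSubalgebra) := by rw [hCA, inf_top_eq]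
      _ ≤ M ⊓ C ⊔ A.toLieSubalgebra := LieSubalgebra.inf_sup_le_of_toLieSubalgebra_le C hAM
      _ ≤ M ⊓ C ⊔ B.toLieSubalgebra := sup_le_sup_left (toLieSubalgebra_mono hAB) _

/-- If the subalgebras above `B` have complements relative to `B`, and the chief factor `B/A` is
complemented, then the subalgebras above `A` have complements relative to `A`. -/
theorem exists_relative_complement_of_covBy [LieAlgebra.IsSolvable L] {A B : LieIdeal R L}
    (h : A ⋖ B) {M : LieSubalgebra R L} (hinf : M ⊓ B.toLieSubalgebra = A.toLieSubalgebra)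
    (hsup : M ⊔ B.toLieSubalgebra = ⊤)
    (hB : ∀ S : LieSubalgebra R L, B.toLieSubalgebra ≤ S →
      ∃ T : LieSubalgebra R L, B.toLieSubalgebra ≤ T ∧ S ⊓ T = B.toLieSubalgebra ∧ S ⊔ T = ⊤)
    (S : LieSubalgebra R L) (hS : A.toLieSubalgebra ≤ S) :
    ∃ T : LieSubalgebra R L, A.toLieSubalgebra ≤ T ∧ S ⊓ T = A.toLieSubalgebra ∧ S ⊔ T = ⊤ := by
  have hAB := toLieSubalgebra_mono h.le
  have hAM : A.toLieSubalgebra ≤ M := hinf ▸ inf_le_left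
  obtain ⟨T, hBT, hST, hST'⟩ := hB (S ⊔ B.toLieSubalgebra) le_sup_right
  have hSTB : S ⊓ T ≤ B.toLieSubalgebra := hST ▸ inf_le_inf_right T le_sup_left
  by_cases hSB : S ⊓ B.toLieSubalgebra = A.toLieSubalgebra
  · refine ⟨T, hAB.trans hBT, le_antisymm ?_ (le_inf hS (hAB.trans hBT)), ?_⟩
    · exact hSB ▸ le_inf inf_le_left hSTB
    · rw [eq_top_iff, ← hST']
      exact sup_le (sup_le le_sup_left (hBT.trans le_sup_right)) le_sup_right
  · have hAT : A.toLieSubalgebra ≤ T ⊓ M := le_inf (hAB.trans hBT) hAM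
    refine ⟨T ⊓ M, hAT, le_antisymm ?_ (le_inf hS hAT), ?_⟩
    · rw [← inf_assoc, ← hinf, inf_comm M]
      exact inf_le_inf_right M hSTB
    -- `U` supplements `B`; since `S ≤ U` already meets `B` in more than `A`, the dichotomy forces
    -- `B ≤ U`, so `U = L`.
    · set U := S ⊔ T ⊓ M
      have hTU : T ≤ U ⊔ B.toLieSubalgebra := calc
        T = T ⊓ (M ⊔ B.toLieSubalgebra) := by rw [hsup, inf_top_eq]
        _ ≤ T ⊓ M ⊔ B.toLieSubalgebra := LieSubalgebra.inf_sup_le_of_toLieSubalgebra_le M hBT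
        _ ≤ U ⊔ B.toLieSubalgebra := sup_le_sup_right le_sup_right _
      have hUB : U ⊔ B.toLieSubalgebra = ⊤ := by
        rw [eq_top_iff, ← hST']
        exact sup_le (sup_le_sup_right le_sup_left _) hTU
      rcases inf_eq_or_le_of_covBy h (hS.trans le_sup_left) hUB with h' | h'
      · refine absurd (le_antisymm ?_ (le_inf hS hAB)) hSB
        exact h' ▸ inf_le_inf_right _ le_sup_left
      · rwa [sup_eq_left.2 h'] at hUB

end LieIdeal

/-! ### Complements, `φ`-freeness and splitting. -/

namespace LieAlgebra

variable {R L : Type*} [CommRing R] [LieRing L] [LieAlgebra R L]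

/-- The epimorphic images of a complemented Lie algebra are `φ`-free. -/
theorem isPhiFree_of_complementedLattice [IsNoetherian R L]
    [ComplementedLattice (LieSubalgebra R L)] {L' : Type*} [LieRing L'] [LieAlgebra R L']
    (f : L →ₗ⁅R⁆ L') (hf : Function.Surjective f) : IsPhiFree R L' := by
  have : IsNoetherian R L' := 
    isNoetherian_of_surjective (f : L →ₗ[R] L') (LinearMap.range_eq_top.2 hf)
  -- The complement `T` maps onto `L'`: the preimage of a maximal subalgebra above its image would
  -- contain both `T` and the preimage of `φ(L')`.
  obtain ⟨T, hT⟩ := exists_isCompl ((frattini R L').comap f)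
  have hmap : T.map f = ⊤ := by
    by_contra hne
    obtain ⟨M, hM, hTM⟩ := (eq_top_or_exists_le_coatom (T.map f)).resolve_left hne
    refine (LieSubalgebra.isCoatom_comap hf hM).1 (eq_top_iff.2 ?_)
    rw [← hT.sup_eq_top]
    refine sup_le (fun x hx ↦ ?_) (LieSubalgebra.map_le_iff_le_comap.1 hTM)
    have hle : frattini R L' ≤ M := sInf_le hM
    exact hle hx
  rw [IsPhiFree, LieSubalgebra.eq_bot_iff]
  intro y hy
  have hyT : y ∈ T.map f := by rw [hmap]; exact LieSubalgebra.mem_top y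
  obtain ⟨t, ht, rfl⟩ := (LieSubalgebra.mem_map _ _ _).1 hyT
  have ht0 : t ∈ (frattini R L').comap f ⊓ T := (LieSubalgebra.mem_inf _ _ _).2 ⟨hy, ht⟩
  rw [hT.inf_eq_bot, LieSubalgebra.mem_bot] at ht0
  rw [ht0, map_zero]

/-- A solvable Lie algebra all of whose quotients are `φ`-free splits over every ideal. -/
theorem splitsOver_of_forall_isPhiFree [IsSolvable L] [IsNoetherian R L] [IsArtinian R L]
    (h : ∀ A : LieIdeal R L, IsPhiFree R (L ⧸ A)) (I : LieIdeal R L) : SplitsOver I := by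
  have : WellFoundedLT (LieIdeal R L) := LieSubmodule.wellFoundedLT_of_isArtinian R L L
  have hne : {A : LieIdeal R L | A ≤ I ∧ SplitsOver A}.Nonempty :=
    ⟨⊥, bot_le, ⊤, by simpa using isCompl_bot_top⟩
  obtain ⟨A, ⟨hAI, hA⟩, hmax⟩ := wellFounded_gt.has_min _ hne
  rcases hAI.eq_or_lt with rfl | hlt
  · exact hA
  · obtain ⟨B, hAB, hBI⟩ := exists_covBy_le_of_lt hlt
    obtain ⟨M, hM, hAM, hBM⟩ := LieIdeal.exists_isCoatom_of_isPhiFree hAB.lt (h A)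
    exact absurd hAB.lt (hmax B ⟨hBI, LieIdeal.splitsOver_of_splitsOver hAB.le
      (LieIdeal.inf_eq_of_isCoatom hAB hM hAM hBM) (LieIdeal.sup_eq_top_of_isCoatom hM hBM) hA⟩)

theorem SplitsOver.exists_supplement {A B : LieIdeal R L} (hAB : A ≤ B) (hB : SplitsOver B) :
    ∃ M : LieSubalgebra R L, M ⊓ B.toLieSubalgebra = A.toLieSubalgebra ∧
      M ⊔ B.toLieSubalgebra = ⊤ := by
  obtain ⟨C, hC⟩ := hB
  have hAB' := LieIdeal.toLieSubalgebra_mono hAB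
  -- The witness is `C + A`; by Dedekind's law its intersection with `B` is `(B ∩ C) + A = A`.
  refine ⟨C ⊔ A.toLieSubalgebra, le_antisymm ?_ (le_inf le_sup_right hAB'), ?_⟩
  · rw [inf_comm]
    refine (LieSubalgebra.inf_sup_le_of_toLieSubalgebra_le C hAB').trans (sup_le ?_ le_rfl)
    rintro x ⟨hxB, hxC⟩
    rw [Submodule.disjoint_def.1 hC.disjoint x hxB hxC]
    exact zero_mem _
  · rw [eq_top_iff, ← LieSubalgebra.toSubmodule_le_toSubmodule,
      LieSubalgebra.sup_toLieSubalgebra_toSubmodule, LieSubalgebra.top_toSubmodule,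
      ← hC.sup_eq_top]
    exact sup_le le_sup_right
      (le_sup_of_le_left (LieSubalgebra.toSubmodule_le_toSubmodule _ _ |>.2 le_sup_left))

/-! ### Chief series and prefrattini subalgebras. -/

namespace ChiefSeries

theorem nonempty [IsNoetherian R L] [IsArtinian R L] : Nonempty (ChiefSeries R L) := by
  have : WellFoundedLT (LieIdeal R L) := LieSubmodule.wellFoundedLT_of_isArtinian R L L
  obtain ⟨a, h0, n, hn, h⟩ :=
    exists_covBy_seq_of_wellFoundedLT_wellFoundedGT (LieIdeal R L)
  exact ⟨{ length := n
           ideal := fun i ↦ a i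
           ideal_zero := by simpa using h0.eq_bot
           ideal_last := by simpa using hn.eq_top
           covBy := fun i ↦ by simpa using h i i.2 }⟩

theorem exists_mem_maximals (s : ChiefSeries R L) {i : Fin s.length}
    (hi : ¬ s.IsFrattiniFactor i) : ∃ M, M ∈ s.maximals i := by
  simp only [IsFrattiniFactor, not_forall] at hi
  obtain ⟨x, hx, hxf⟩ := hi
  obtain ⟨M, hM, hAM, hxM⟩ := LieIdeal.exists_isCoatom_of_not_mem_frattini hxf
  exact ⟨M, hM, hAM, fun hBM ↦ hxM (hBM hx)⟩

theorem not_isFrattiniFactor_of_isPhiFree (s : ChiefSeries R L) (i : Fin s.length)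
    (h : IsPhiFree R (L ⧸ s.ideal i.castSucc)) : ¬ s.IsFrattiniFactor i := by
  intro hi
  refine (s.covBy i).lt.not_ge fun x hx ↦ ?_
  have := hi x hx
  rw [h, LieSubalgebra.mem_bot] at this
  exact LieSubmodule.Quotient.mk_eq_zero'.1 this

theorem ideal_monotone (s : ChiefSeries R L) : Monotone s.ideal :=
  Fin.monotone_iff_le_succ.2 fun i ↦ (s.covBy i).le

theorem toLieSubalgebra_ideal_zero (s : ChiefSeries R L) : (s.ideal 0).toLieSubalgebra = ⊥ := by
  rw [s.ideal_zero, ← LieSubalgebra.toSubmodule_eq_bot]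
  simp

theorem toLieSubalgebra_ideal_last (s : ChiefSeries R L) :
    (s.ideal (Fin.last _)).toLieSubalgebra = ⊤ := by
  rw [s.ideal_last, LieIdeal.top_toLieSubalgebra]

/-- A solvable Lie algebra with a chief series of complemented factors is complemented. -/
theorem complementedLattice [IsSolvable L] (s : ChiefSeries R L)
    (h : ∀ i : Fin s.length, ∃ M : LieSubalgebra R L,
      M ⊓ (s.ideal i.succ).toLieSubalgebra = (s.ideal i.castSucc).toLieSubalgebra ∧
        M ⊔ (s.ideal i.succ).toLieSubalgebra = ⊤) :
    ComplementedLattice (LieSubalgebra R L) := by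
  have key : ∀ j : Fin (s.length + 1), ∀ S : LieSubalgebra R L,
      (s.ideal j).toLieSubalgebra ≤ S → ∃ T : LieSubalgebra R L,
        (s.ideal j).toLieSubalgebra ≤ T ∧ S ⊓ T = (s.ideal j).toLieSubalgebra ∧ S ⊔ T = ⊤ := by
    intro j
    induction j using Fin.reverseInduction with
    | last =>
      intro S hS
      rw [s.toLieSubalgebra_ideal_last] at hS ⊢
      exact ⟨⊤, le_rfl, by rw [inf_top_eq, top_le_iff.1 hS], sup_top_eq S⟩
    | cast i ih =>
      obtain ⟨M, hinf, hsup⟩ := h i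
      exact LieIdeal.exists_relative_complement_of_covBy (s.covBy i) hinf hsup ih
  refine ⟨fun S ↦ ?_⟩
  obtain ⟨T, -, hinf, hsup⟩ := key 0 S (by rw [s.toLieSubalgebra_ideal_zero]; exact bot_le)
  rw [s.toLieSubalgebra_ideal_zero] at hinf
  exact ⟨T, disjoint_iff.2 hinf, codisjoint_iff.2 hsup⟩

/-- Intersecting supplements of successive factors loses nothing modulo the ideal reached:
Dedekind's law applies at each step because `N i` contains the lower term. -/
theorem iInf_sup_eq_top (s : ChiefSeries R L) (N : Fin s.length → LieSubalgebra R L)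
    (hle : ∀ i, (s.ideal i.castSucc).toLieSubalgebra ≤ N i)
    (hsup : ∀ i, N i ⊔ (s.ideal i.succ).toLieSubalgebra = ⊤) (j : Fin (s.length + 1)) :
    (⨅ (i : Fin s.length) (_ : i.castSucc < j), N i) ⊔ (s.ideal j).toLieSubalgebra = ⊤ := by
  induction j using Fin.induction with
  | zero => simp
  | succ k ih =>
    set C := ⨅ (i : Fin s.length) (_ : i.castSucc < k.castSucc), N i
    have hC : N k ⊓ C ≤ ⨅ (i : Fin s.length) (_ : i.castSucc < k.succ), N i := by
      refine le_iInf₂ fun i hi ↦ ?_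
      rcases (Fin.castSucc_lt_succ_iff.1 hi).eq_or_lt with rfl | hlt
      · exact inf_le_left
      · exact inf_le_right.trans (iInf₂_le i (Fin.castSucc_lt_castSucc_iff.2 hlt))
    rw [eq_top_iff, ← hsup k]
    refine sup_le ?_ le_sup_right
    calc N k = N k ⊓ (C ⊔ (s.ideal k.castSucc).toLieSubalgebra) := by rw [ih, inf_top_eq]
      _ ≤ N k ⊓ C ⊔ (s.ideal k.castSucc).toLieSubalgebra :=
        LieSubalgebra.inf_sup_le_of_toLieSubalgebra_le C (hle k)
      _ ≤ _ := sup_le_sup hC (LieIdeal.toLieSubalgebra_mono (s.covBy k).le)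

/-- If some chief factor of the series is Frattini, then the prefrattini subalgebras are
nonzero. -/
theorem IsPrefrattini.ne_bot {s : ChiefSeries R L} {B : LieSubalgebra R L}
    (hB : s.IsPrefrattini B) {k : Fin s.length} (hk : s.IsFrattiniFactor k) : B ≠ ⊥ := by
  obtain ⟨M, hM, rfl⟩ := hB
  -- The empty infimum makes `N i = ⊤` at Frattini indices, so the supplement conditions hold at
  -- every index.
  set N : Fin s.length → LieSubalgebra R L := fun i ↦ ⨅ (_ : ¬ s.IsFrattiniFactor i), M i with hN
  have hle : ∀ i, (s.ideal i.castSucc).toLieSubalgebra ≤ N i :=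
    fun i ↦ le_iInf fun hi ↦ (hM i hi).2.1
  have hsup : ∀ i, N i ⊔ (s.ideal i.succ).toLieSubalgebra = ⊤ := by
    intro i
    by_cases hi : s.IsFrattiniFactor i
    · simp [hN, hi]
    · simpa [hN, hi] using LieIdeal.sup_eq_top_of_isCoatom (hM i hi).1 (hM i hi).2.2
  have htop := s.iInf_sup_eq_top N hle hsup k.castSucc
  set C := ⨅ (i : Fin s.length) (_ : i.castSucc < k.castSucc), N i
  -- Indices below `k` are handled by `C`, `k` itself by `N k = ⊤`, and later ones because `N i`
  -- contains its lower term, hence the upper term of factor `k`.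
  have hC : (s.ideal k.succ).toLieSubalgebra ⊓ C ≤ ⨅ i, N i := by
    refine le_iInf fun i ↦ ?_
    rcases lt_trichotomy i k with hlt | rfl | hlt
    · exact inf_le_right.trans (iInf₂_le i (Fin.castSucc_lt_castSucc_iff.2 hlt))
    · simp [hN, hk]
    · exact inf_le_left.trans ((LieIdeal.toLieSubalgebra_mono
        (s.ideal_monotone (Fin.succ_le_castSucc_iff.2 hlt))).trans (hle i))
  intro hbot
  refine (s.covBy k).lt.not_ge ?_
  have := calc
    (s.ideal k.succ).toLieSubalgebra
      = (s.ideal k.succ).toLieSubalgebra ⊓ (C ⊔ (s.ideal k.castSucc).toLieSubalgebra) := by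
        rw [htop, inf_top_eq]
    _ ≤ (s.ideal k.succ).toLieSubalgebra ⊓ C ⊔ (s.ideal k.castSucc).toLieSubalgebra :=
        LieSubalgebra.inf_sup_le_of_toLieSubalgebra_le C
          (LieIdeal.toLieSubalgebra_mono (s.covBy k).le)
    _ ≤ (s.ideal k.castSucc).toLieSubalgebra := sup_le ((hC.trans hbot.le).trans bot_le) le_rfl
  exact fun x hx ↦ this hx

theorem exists_isPrefrattini (s : ChiefSeries R L) : ∃ B, s.IsPrefrattini B := by
  choose! M hM using fun i (hi : ¬ s.IsFrattiniFactor i) ↦ s.exists_mem_maximals hi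
  exact ⟨_, M, hM, rfl⟩

/-- If no chief factor of the series is Frattini, then the prefrattini subalgebras vanish. -/
theorem IsPrefrattini.eq_bot [IsSolvable L] {s : ChiefSeries R L} {B : LieSubalgebra R L}
    (hB : s.IsPrefrattini B) (h : ∀ i, ¬ s.IsFrattiniFactor i) : B = ⊥ := by
  obtain ⟨M, hM, rfl⟩ := hB
  set B := ⨅ (i : Fin s.length) (_ : ¬ s.IsFrattiniFactor i), M i
  -- Inductive step: `B ≤ M i`, and `M i` meets the upper term only in the lower one.
  have key : ∀ j, B ⊓ (s.ideal j).toLieSubalgebra = ⊥ := by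
    intro j
    induction j using Fin.induction with
    | zero => rw [s.toLieSubalgebra_ideal_zero, inf_bot_eq]
    | succ i ih =>
      have hBM : B ≤ M i := iInf₂_le i (h i)
      obtain ⟨hco, hA, hB⟩ := hM i (h i)
      rw [eq_bot_iff, ← ih, ← LieIdeal.inf_eq_of_isCoatom (s.covBy i) hco hA hB]
      exact le_inf inf_le_left (inf_le_inf_right _ hBM)
  simpa [s.toLieSubalgebra_ideal_last] using key (Fin.last _)

end ChiefSeries

end LieAlgebra

/-! ### The equivalences. -/

theorem theorem2p1 {F : Type*} {L : Type u} [Field F] [LieRing L] [LieAlgebra F L]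
    [FiniteDimensional F L] [LieAlgebra.IsSolvable L] :
    Nonempty (LieAlgebra.ChiefSeries F L) ∧
    ∀ s : LieAlgebra.ChiefSeries F L,
      List.TFAE [
        ComplementedLattice (LieSubalgebra F L),
        ∀ B : LieSubalgebra F L, s.IsPrefrattini B → B = ⊥,
        LieAlgebra.IsPhiFree F L ∧
          ∀ (L' : Type u) [LieRing L'] [LieAlgebra F L'] (f : L →ₗ⁅F⁆ L'),
            Function.Surjective f → LieAlgebra.IsPhiFree F L',
        ∀ I : LieIdeal F L, LieAlgebra.SplitsOver I] := by
  refine ⟨LieAlgebra.ChiefSeries.nonempty, fun s ↦ ?_⟩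
  tfae_have 1 → 3 := fun _ ↦
    ⟨LieAlgebra.isPhiFree_of_complementedLattice LieHom.id Function.surjective_id,
      fun L' _ _ f hf ↦ LieAlgebra.isPhiFree_of_complementedLattice f hf⟩
  tfae_have 3 → 4 := fun h ↦ LieAlgebra.splitsOver_of_forall_isPhiFree
    fun A ↦ h.2 _ A.quotientMk A.quotientMk_surjective
  tfae_have 4 → 1 := fun h ↦ s.complementedLattice
    fun i ↦ (h (s.ideal i.succ)).exists_supplement (s.covBy i).le
  tfae_have 3 → 2 := fun h B hB ↦ hB.eq_bot fun i ↦ s.not_isFrattiniFactor_of_isPhiFree i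
    (h.2 _ (s.ideal i.castSucc).quotientMk (s.ideal i.castSucc).quotientMk_surjective)
  tfae_have 2 → 1 := fun h ↦ s.complementedLattice fun i ↦ by
    -- One existing prefrattini subalgebra keeps (ii) from being vacuous; its vanishing rules out
    -- Frattini factors.
    obtain ⟨B, hB⟩ := s.exists_isPrefrattini
    obtain ⟨M, hM, hAM, hBM⟩ := s.exists_mem_maximals fun hi ↦ hB.ne_bot hi (h B hB)
    exact ⟨M, LieIdeal.inf_eq_of_isCoatom (s.covBy i) hM hAM hBM,
      LieIdeal.sup_eq_top_of_isCoatom hM hBM⟩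
  tfae_finish
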